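/- Theorem (Alon–Boppana, Serre). Let $k\ge 1$ be an integer and let $\lambda$ be a real number with $\lambda<2\sqrt{k-1}$. Then, up to isomorphism, there are only finitely many finite simple $k$-regular graphs $G$ with at least two vertices whose second largest eigenvalue satisfies $\lambda_2(G)\le\lambda$. Here $\lambda_1(G)\ge\lambda_2(G)\ge\cdots\ge\lambda_n(G)$ denote the eigenvalues of the adjacency matrix of $G$, listed in decreasing order with multiplicity. -/

import Mathlib

/-- The second largest eigenvalue `λ₂(G)` of a finite simple graph `G` with at least two vertices:
the eigenvalues of its real adjacency matrix, counted with multiplicity, are listed in decreasing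
order `λ₁ ≥ λ₂ ≥ ⋯ ≥ λₙ` (by `Matrix.IsHermitian.eigenvalues₀`, indexed from `0`), and `λ₂(G)` is
the entry with index `1`. -/
noncomputable def SimpleGraph.secondEigenvalue {V : Type*} [Fintype V] [DecidableEq V]
    (G : SimpleGraph V) [DecidableRel G.Adj] (hV : 1 < Fintype.card V) : ℝ :=
  (G.isHermitian_adjMatrix ℝ).eigenvalues₀ ⟨1, hV⟩

/-! For `lam < μ < 2√(k-1)`, put a test function `f ≥ 0` on a ball around an edge, radial and with
`A f ≥ μ f`. Its profile solves the tree recursion for `μ`. Below `2√(k-1)` that recursion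
oscillates, so the profile reaches zero at a radius depending only on `k` and `μ`
(`exists_antitone_profile`, `le_adjMatrix_mulVec_radial`). In a large graph `f` is nearly orthogonal
to the constants, so all Rayleigh quotients on the span of `1` and `f` exceed `lam`, forcing `λ₂ >
lam` (`card_mul_le_of_secondEigenvalue_le`). Hence the order is bounded. -/

open Matrix Finset

/-- In the span of two vectors there is a nontrivial combination whose Rayleigh quotient is at most
the second largest eigenvalue. -/
theorem Matrix.IsHermitian.exists_combination_dotProduct_le {V : Type*} [Fintype V] [DecidableEq V]
    {M : Matrix V V ℝ} (hM : M.IsHermitian) (hV : 1 < Fintype.card V) (w z : V → ℝ) :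
    ∃ a b : ℝ, (a ≠ 0 ∨ b ≠ 0) ∧
      (a • w + b • z) ⬝ᵥ M *ᵥ (a • w + b • z) ≤
        hM.eigenvalues₀ ⟨1, hV⟩ * ((a • w + b • z) ⬝ᵥ (a • w + b • z)) := by
  set e : V → V → ℝ := fun i => ⇑(hM.eigenvectorBasis i) with he
  have parseval : ∀ x y : V → ℝ, x ⬝ᵥ y = ∑ i, (e i ⬝ᵥ x) * (e i ⬝ᵥ y) := by
    intro x y
    have h := hM.eigenvectorBasis.sum_inner_mul_inner (WithLp.toLp 2 x) (WithLp.toLp 2 y)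
    simp only [EuclideanSpace.inner_eq_star_dotProduct, star_trivial] at h
    rw [dotProduct_comm x y, ← h]
    exact sum_congr rfl fun i _ => by rw [dotProduct_comm y]
  have eig : ∀ i x, e i ⬝ᵥ M *ᵥ x = hM.eigenvalues i * (e i ⬝ᵥ x) := by
    intro i x
    have hT : Mᵀ = M := by simpa [conjTranspose_eq_transpose_of_trivial] using hM.eq
    rw [dotProduct_mulVec, ← mulVec_transpose, hT, he]
    simp only [hM.mulVec_eigenvectorBasis i, smul_dotProduct, smul_eq_mul]
  set σ : Fin (Fintype.card V) ≃ V := Fintype.equivOfCardEq (Fintype.card_fin _) with hσ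
  set i₀ : V := σ ⟨0, by omega⟩ with hi₀
  -- `i₀` carries the top eigenvalue; every other index sits at position at least `1` in the
  -- decreasing list.
  have small : ∀ i, i ≠ i₀ → hM.eigenvalues i ≤ hM.eigenvalues₀ ⟨1, hV⟩ := by
    intro i hi
    apply hM.eigenvalues₀_antitone
    rw [Fin.le_def]
    by_contra! hlt
    apply hi
    rw [hi₀, ← Equiv.symm_apply_eq]
    ext
    simpa using hlt
  have key : ∀ f : V → ℝ, e i₀ ⬝ᵥ f = 0 →
      f ⬝ᵥ M *ᵥ f ≤ hM.eigenvalues₀ ⟨1, hV⟩ * (f ⬝ᵥ f) := by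
    intro f hf
    rw [parseval f (M *ᵥ f), parseval f f, mul_sum]
    refine sum_le_sum fun i _ => ?_
    rw [eig]
    by_cases hi : i = i₀
    · subst hi; simp [hf]
    · nlinarith [small i hi, mul_self_nonneg (e i ⬝ᵥ f)]
  by_cases hw : e i₀ ⬝ᵥ w = 0
  · exact ⟨1, 0, by simp, key _ (by simp [hw])⟩
  · refine ⟨e i₀ ⬝ᵥ z, -(e i₀ ⬝ᵥ w), by simp [hw], key _ ?_⟩
    simp only [dotProduct_add, dotProduct_smul, smul_eq_mul]
    ring

/-! ### The radial profile -/

/-- The radial profile of the test function: a solution of the recursion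
`g i + q * g (i + 2) = μ * g (i + 1)`, cut off as soon as it stops being positive. -/
noncomputable def radialProfile (q μ : ℝ) : ℕ → ℝ
  | 0 => 1
  | 1 => 1
  | i + 2 => max 0 ((μ * radialProfile q μ (i + 1) - radialProfile q μ i) / q)

theorem radialProfile_nonneg (q μ : ℝ) : ∀ i, 0 ≤ radialProfile q μ i
  | 0 => zero_le_one
  | 1 => zero_le_one
  | _ + 2 => le_max_left _ _

theorem radialProfile_succ_le {q μ : ℝ} (hq : 0 < q) (hμ : μ ≤ q + 1) (i : ℕ) :
    radialProfile q μ (i + 1) ≤ radialProfile q μ i := by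
  induction i with
  | zero => exact le_rfl
  | succ i ih =>
    have h0 := radialProfile_nonneg q μ (i + 1)
    rw [radialProfile, max_le_iff, div_le_iff₀ hq]
    exact ⟨h0, by nlinarith⟩

theorem le_radialProfile_add_two {q μ : ℝ} (hq : 0 < q) (i : ℕ) :
    μ * radialProfile q μ (i + 1) ≤ radialProfile q μ i + q * radialProfile q μ (i + 2) := by
  have h : (μ * radialProfile q μ (i + 1) - radialProfile q μ i) / q ≤
      radialProfile q μ (i + 2) := le_max_right _ _
  rw [div_le_iff₀ hq] at h
  linarith

/-- While the profile is positive, its successive ratios satisfy `ρ' = (μ - 1/ρ)/q`. By AM-GM, `qρ +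
1/ρ ≥ 2√q`, so each step lowers the ratio by at least `δ`, and it cannot stay positive forever. -/
theorem exists_radialProfile_eq_zero {q μ : ℝ} (hq : 0 < q) (hμ : μ < 2 * √q) :
    ∃ N, radialProfile q μ N = 0 := by
  by_contra! hne
  have pos : ∀ i, 0 < radialProfile q μ i := fun i =>
    (radialProfile_nonneg q μ i).lt_of_ne (hne i).symm
  set δ : ℝ := (2 * √q - μ) / q with hδ
  have hδ0 : 0 < δ := div_pos (by linarith) hq
  set ρ : ℕ → ℝ := fun i => radialProfile q μ (i + 1) / radialProfile q μ i with hρ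
  have ρpos : ∀ i, 0 < ρ i := fun i => div_pos (pos _) (pos _)
  have step : ∀ i, ρ (i + 1) ≤ ρ i - δ := by
    intro i
    have hrec : radialProfile q μ (i + 2) =
        (μ * radialProfile q μ (i + 1) - radialProfile q μ i) / q := by
      have h := pos (i + 2)
      rw [radialProfile] at h ⊢
      rcases lt_max_iff.1 h with h | h
      · exact absurd h (lt_irrefl _)
      · exact max_eq_right h.le
    have hρ' : ρ (i + 1) = (μ - 1 / ρ i) / q := by
      have h1 := (pos i).ne'
      have h2 := (pos (i + 1)).ne'
      simp only [hρ, hrec]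
      field_simp
    have hamgm : 2 * √q ≤ q * ρ i + 1 / ρ i := by
      have h1 : 0 < ρ i := ρpos i
      have h2 : √q ^ 2 = q := Real.sq_sqrt hq.le
      have h3 : q * ρ i + 1 / ρ i - 2 * √q = (√q * ρ i - 1) ^ 2 / ρ i := by
        field_simp
        nlinarith
      have h4 : 0 ≤ (√q * ρ i - 1) ^ 2 / ρ i := by positivity
      linarith
    rw [hρ', hδ, div_le_iff₀ hq, sub_mul, div_mul_cancel₀ _ hq.ne']
    linarith
  have bound : ∀ i : ℕ, ρ i ≤ ρ 0 - i * δ := by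
    intro i
    induction i with
    | zero => simp
    | succ i ih => push_cast; linarith [step i]
  obtain ⟨n, hn⟩ := exists_nat_gt (ρ 0 / δ)
  rw [div_lt_iff₀ hδ0] at hn
  linarith [bound n, ρpos n]

/-- A nonincreasing, eventually vanishing profile satisfying the inequality that makes the
associated radial function on a `(q + 1)`-regular graph a subsolution. -/
theorem exists_antitone_profile {q μ : ℝ} (hq : 0 ≤ q) (hμ : μ < 2 * √q) :
    ∃ (g : ℕ → ℝ) (N : ℕ), Antitone g ∧ (∀ i, 0 ≤ g i) ∧ g 0 = 1 ∧ g 1 = 1 ∧ g N = 0 ∧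
      ∀ i, μ * g (i + 1) ≤ g i + q * g (i + 2) := by
  rcases hq.eq_or_lt with rfl | hq
  -- Degree one: the recursion cannot be solved for `g (i + 2)`, but a step function suffices.
  · have hμ : μ ≤ 0 := by simpa using hμ.le
    refine ⟨fun i => if i ≤ 1 then 1 else 0, 2, ?_, ?_, by simp, by simp, by simp, ?_⟩
    · intro i j hij
      dsimp only
      split_ifs <;> first | omega | norm_num
    · intro i
      dsimp only
      split_ifs <;> norm_num
    · intro i
      dsimp only
      split_ifs <;> first | omega | linarith
  · obtain ⟨N, hN⟩ := exists_radialProfile_eq_zero hq hμ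
    have hle : μ ≤ q + 1 := by
      nlinarith [sq_nonneg (√q - 1), Real.sq_sqrt hq.le]
    exact ⟨radialProfile q μ, N, antitone_nat_of_succ_le (radialProfile_succ_le hq hle),
      radialProfile_nonneg q μ, rfl, rfl, hN, le_radialProfile_add_two hq⟩

/-! ### Balls and radial functions in a regular graph -/

namespace SimpleGraph

variable {V : Type*} [Fintype V] [DecidableEq V] (G : SimpleGraph V) [DecidableRel G.Adj]

/-- The set of vertices at distance at most `i` from `s`. -/
def ballFinset (s : Finset V) : ℕ → Finset V
  | 0 => s
  | i + 1 => ballFinset s i ∪ (ballFinset s i).biUnion fun x => G.neighborFinset x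

theorem card_ballFinset_le {k : ℕ} (hG : G.IsRegularOfDegree k) (s : Finset V) (i : ℕ) :
    #(G.ballFinset s i) ≤ #s * (k + 1) ^ i := by
  induction i with
  | zero => simp [ballFinset]
  | succ i ih =>
    have h : #((G.ballFinset s i).biUnion fun x => G.neighborFinset x) ≤ #(G.ballFinset s i) * k :=
      card_biUnion_le_card_mul _ _ _ fun x _ => (hG x).le
    calc #(G.ballFinset s (i + 1)) ≤ #(G.ballFinset s i) + #(G.ballFinset s i) * k :=
          (card_union_le _ _).trans (by gcongr)
      _ = #(G.ballFinset s i) * (k + 1) := by ring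
      _ ≤ #s * (k + 1) ^ i * (k + 1) := by gcongr
      _ = #s * (k + 1) ^ (i + 1) := by ring

theorem ballFinset_mono (s : Finset V) : Monotone (G.ballFinset s) :=
  monotone_nat_of_le_succ fun _ => subset_union_left

/-- The distance from `x` to `s`, truncated at `N`. -/
def truncDist (s : Finset V) (N : ℕ) (x : V) : ℕ :=
  Nat.find (⟨N, Or.inr le_rfl⟩ : ∃ i, x ∈ G.ballFinset s i ∨ N ≤ i)

variable {G} {s : Finset V} {N : ℕ} {x y : V}

theorem truncDist_le_of_mem {i : ℕ} (h : x ∈ G.ballFinset s i) : G.truncDist s N x ≤ i :=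
  Nat.find_min' _ (Or.inl h)

theorem mem_ballFinset_truncDist (h : G.truncDist s N x < N) :
    x ∈ G.ballFinset s (G.truncDist s N x) :=
  (Nat.find_spec (⟨N, Or.inr le_rfl⟩ : ∃ i, x ∈ G.ballFinset s i ∨ N ≤ i)).resolve_right
    (not_le.2 h)

theorem truncDist_le_add_one (h : G.Adj x y) : G.truncDist s N y ≤ G.truncDist s N x + 1 := by
  rcases lt_or_ge (G.truncDist s N x) N with hx | hx
  · refine truncDist_le_of_mem (mem_union_right _ (mem_biUnion.2 ⟨x, ?_, ?_⟩))
    · exact mem_ballFinset_truncDist hx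
    · simpa using h
  · exact (Nat.find_min' _ (Or.inr le_rfl)).trans (hx.trans (Nat.le_succ _))

/-- The strict bound by `N` is needed: the value `N` is also given to vertices that no ball reaches.
-/
theorem exists_adj_truncDist_le {i : ℕ} (hi : G.truncDist s N x = i + 1) (hN : i + 1 < N) :
    ∃ y, G.Adj x y ∧ G.truncDist s N y ≤ i := by
  have hx := mem_ballFinset_truncDist (hi ▸ hN : G.truncDist s N x < N)
  rw [hi, ballFinset, mem_union] at hx
  rcases hx with hx | hx
  · have := truncDist_le_of_mem (N := N) hx
    omega
  · obtain ⟨y, hy, hxy⟩ := mem_biUnion.1 hx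
    exact ⟨y, ((mem_neighborFinset _ _ _).1 hxy).symm, truncDist_le_of_mem hy⟩

/-- A radial function around an edge is a subsolution of `A f = μ f`. -/
theorem le_adjMatrix_mulVec_radial {k : ℕ} (hG : G.IsRegularOfDegree k) {u v : V}
    (huv : G.Adj u v) {μ : ℝ} {g : ℕ → ℝ} (anti : Antitone g) (nonneg : ∀ i, 0 ≤ g i)
    (h01 : g 1 = g 0) (hN : g N = 0)
    (hrec : ∀ i, μ * g (i + 1) ≤ g i + ((k : ℝ) - 1) * g (i + 2)) (x : V) :
    μ * g (G.truncDist {u, v} N x + 1) ≤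
      (G.adjMatrix ℝ *ᵥ fun y => g (G.truncDist {u, v} N y + 1)) x := by
  rw [adjMatrix_mulVec_apply]
  rcases lt_or_ge (G.truncDist {u, v} N x) N with hx | hx
  -- One neighbour lies nearer the edge. At distance `0` the other endpoint plays this role, thanks
  -- to `g 1 = g 0`.
  · obtain ⟨y, hxy, hy⟩ : ∃ y, G.Adj x y ∧
        g (G.truncDist {u, v} N x) ≤ g (G.truncDist {u, v} N y + 1) := by
      rcases hd : G.truncDist {u, v} N x with _ | i
      · have hmem := mem_ballFinset_truncDist hx
        rw [hd, ballFinset, mem_insert, mem_singleton] at hmem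
        have h0 : ∀ y ∈ ({u, v} : Finset V), G.truncDist {u, v} N y = 0 := fun y hy =>
          Nat.le_zero.1 (truncDist_le_of_mem (i := 0) hy)
        rcases hmem with rfl | rfl
        · exact ⟨v, huv, by rw [h0 v (by simp), zero_add, h01]⟩
        · exact ⟨u, huv.symm, by rw [h0 u (by simp), zero_add, h01]⟩
      · obtain ⟨y, hxy, hy⟩ := exists_adj_truncDist_le hd (hd ▸ hx)
        exact ⟨y, hxy, anti (by omega)⟩
    have hmem : y ∈ G.neighborFinset x := by simpa using hxy
    have hcard : #((G.neighborFinset x).erase y) + 1 = k :=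
      (card_erase_add_one hmem).trans (hG x)
    have hcard' : (#((G.neighborFinset x).erase y) : ℝ) = (k : ℝ) - 1 := by
      rw [← hcard]; push_cast; ring
    rw [← add_sum_erase _ _ hmem]
    -- The other `k - 1` neighbours are at most one step further out, and `g` is nonincreasing.
    have hrest : ((k : ℝ) - 1) * g (G.truncDist {u, v} N x + 2) ≤
        ∑ z ∈ (G.neighborFinset x).erase y, g (G.truncDist {u, v} N z + 1) := by
      rw [← hcard', ← nsmul_eq_mul]
      refine card_nsmul_le_sum _ _ _ fun z hz => anti ?_
      have := truncDist_le_add_one (s := {u, v}) (N := N)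
        ((mem_neighborFinset _ _ _).1 (mem_of_mem_erase hz))
      omega
    linarith [hrec (G.truncDist {u, v} N x)]
  · have h0 : g (G.truncDist {u, v} N x + 1) = 0 :=
      le_antisymm (hN ▸ anti (by omega)) (nonneg _)
    rw [h0, mul_zero]
    exact sum_nonneg fun z _ => nonneg _

/-- A regular graph whose second eigenvalue is at most `lam`, and which carries a subsolution of
`A f = μ f` with `lam < μ`, has boundedly many vertices. -/
theorem card_mul_le_of_secondEigenvalue_le {k : ℕ} (hG : G.IsRegularOfDegree k)
    (hV : 1 < Fintype.card V) {lam μ : ℝ} (hlk : lam < k) (hle : G.secondEigenvalue hV ≤ lam)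
    {f : V → ℝ} (hf0 : ∀ x, 0 ≤ f x) (hf : f ≠ 0)
    (hsub : ∀ x, μ * f x ≤ (G.adjMatrix ℝ *ᵥ f) x) {t : Finset V}
    (ht : ∀ x, x ∉ t → f x = 0) :
    (μ - lam) * Fintype.card V ≤ (k - lam) * #t := by
  by_contra! hlt
  obtain ⟨a, b, hab, hray⟩ := (G.isHermitian_adjMatrix ℝ).exists_combination_dotProduct_le hV 1 f
  set A := G.adjMatrix ℝ with hA
  set n : ℝ := (Fintype.card V : ℝ) with hn
  have hA1 : A *ᵥ 1 = (k : ℝ) • (1 : V → ℝ) := by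
    ext x
    simp [hA, adjMatrix_mulVec_apply, hG x]
  have h1A : (1 : V → ℝ) ⬝ᵥ A *ᵥ f = k * ((1 : V → ℝ) ⬝ᵥ f) := by
    rw [dotProduct_mulVec, ← mulVec_transpose, hA, transpose_adjMatrix, ← hA, hA1,
      smul_dotProduct, smul_eq_mul]
  have h11 : (1 : V → ℝ) ⬝ᵥ 1 = n := by simp [hn]
  have hFpos : 0 < f ⬝ᵥ f := by
    have := dotProduct_star_self_pos_iff.2 hf
    simpa using this
  have hfAf : μ * (f ⬝ᵥ f) ≤ f ⬝ᵥ A *ᵥ f := by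
    simp only [dotProduct, mul_sum]
    exact sum_le_sum fun x _ => by nlinarith [hsub x, hf0 x]
  -- Cauchy–Schwarz on the support: this is the near-orthogonality of `f` to the constants.
  have hs : ((1 : V → ℝ) ⬝ᵥ f) ^ 2 ≤ #t * (f ⬝ᵥ f) := by
    have h1 : (1 : V → ℝ) ⬝ᵥ f = ∑ x ∈ t, f x := by
      rw [one_dotProduct]
      exact (sum_subset (subset_univ t) fun x _ hx => ht x hx).symm
    have h2 : ∑ x ∈ t, f x ^ 2 ≤ f ⬝ᵥ f := by
      simp only [dotProduct, ← sq]
      exact sum_le_sum_of_subset_of_nonneg (subset_univ t) fun x _ _ => sq_nonneg _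
    rw [h1]
    exact (sq_sum_le_card_mul_sum_sq).trans (by gcongr)
  have hself : 0 ≤ (a • (1 : V → ℝ) + b • f) ⬝ᵥ (a • (1 : V → ℝ) + b • f) := by
    simpa using dotProduct_star_self_nonneg (a • (1 : V → ℝ) + b • f)
  have hray' := hray.trans (mul_le_mul_of_nonneg_right hle hself)
  rw [← hA] at hray'
  simp only [mulVec_add, mulVec_smul, dotProduct_add, add_dotProduct, dotProduct_smul,
    smul_dotProduct, smul_eq_mul, hA1, h1A, h11, dotProduct_comm f 1] at hray'
  set s := (1 : V → ℝ) ⬝ᵥ f with hs'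
  set F := f ⬝ᵥ f with hF
  have hn0 : 0 < n := by rw [hn]; exact_mod_cast (by omega : 0 < Fintype.card V)
  have hquad : (k - lam) * (a ^ 2 * n + 2 * (a * b * s)) + b ^ 2 * ((μ - lam) * F) ≤ 0 := by
    nlinarith [mul_le_mul_of_nonneg_left hfAf (sq_nonneg b)]
  have hkl : 0 < k - lam := by linarith
  -- Multiply by `n` and complete the square; `hgap` then makes the form positive definite in `(a,
  -- b)`, a contradiction.
  have hsq : (k - lam) * (a * n + b * s) ^ 2 +
      b ^ 2 * ((μ - lam) * n * F - (k - lam) * s ^ 2) ≤ 0 := by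
    nlinarith [mul_le_mul_of_nonneg_left hquad hn0.le]
  have hgap : 0 < (μ - lam) * n * F - (k - lam) * s ^ 2 := by
    nlinarith [mul_le_mul_of_nonneg_left hs hkl.le, mul_lt_mul_of_pos_right hlt hFpos]
  have hb : b = 0 := by
    by_contra hb
    have : 0 < b ^ 2 * ((μ - lam) * n * F - (k - lam) * s ^ 2) := by positivity
    nlinarith [mul_nonneg hkl.le (sq_nonneg (a * n + b * s))]
  have ha : a ≠ 0 := hab.resolve_right (not_not.2 hb)
  subst hb
  have : 0 < (k - lam) * (a * n + 0 * s) ^ 2 := by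
    rw [zero_mul, add_zero]
    positivity
  linarith

end SimpleGraph

/-! ### The bound on the order and finiteness -/

theorem exists_card_bound (k : ℕ) (hk : 1 ≤ k) (lam : ℝ)
    (hlam : lam < 2 * √((k : ℝ) - 1)) :
    ∃ B : ℕ, ∀ (V : Type*) [Fintype V] [DecidableEq V] (G : SimpleGraph V) [DecidableRel G.Adj]
      (hV : 1 < Fintype.card V), G.IsRegularOfDegree k → G.secondEigenvalue hV ≤ lam →
        Fintype.card V ≤ B := by
  have hk' : (0 : ℝ) ≤ (k : ℝ) - 1 := by
    rw [sub_nonneg]; exact_mod_cast hk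
  obtain ⟨μ, hlμ, hμ⟩ := exists_between hlam
  -- AM-GM: `2√(k-1) ≤ k`.
  have hlk : lam < k := by
    nlinarith [sq_nonneg (√((k : ℝ) - 1) - 1), Real.sq_sqrt hk']
  obtain ⟨g, N, anti, nonneg, h0, h1, hN, hrec⟩ := exists_antitone_profile hk' hμ
  refine ⟨⌈(k - lam) * ((2 * (k + 1) ^ N : ℕ) : ℝ) / (μ - lam)⌉₊, ?_⟩
  intro V _ _ G _ hV hG hle
  have : Nonempty V := Fintype.card_pos_iff.1 (by omega)
  obtain ⟨u⟩ := this
  obtain ⟨v, huv⟩ : ∃ v, G.Adj u v := (G.degree_pos_iff_exists_adj u).1 (by rw [hG u]; exact hk)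
  have hcard := SimpleGraph.card_mul_le_of_secondEigenvalue_le hG hV hlk hle
    (μ := μ) (f := fun y => g (G.truncDist {u, v} N y + 1)) (t := G.ballFinset {u, v} N)
    (fun _ => nonneg _)
    (fun h => by
      have hu := congrFun h u
      have hd : G.truncDist {u, v} N u = 0 :=
        Nat.le_zero.1 (SimpleGraph.truncDist_le_of_mem (i := 0) (by simp [SimpleGraph.ballFinset]))
      simp [hd, h1] at hu)
    (SimpleGraph.le_adjMatrix_mulVec_radial hG huv anti nonneg (h1.trans h0.symm) hN hrec)
    -- Outside the ball the truncated distance is `N`, where the profile has already vanished.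
    (fun x hx => by
      refine le_antisymm (hN ▸ anti ?_) (nonneg _)
      by_contra! hlt
      exact hx (G.ballFinset_mono _ (by omega)
        (SimpleGraph.mem_ballFinset_truncDist (by omega : G.truncDist {u, v} N x < N))))
  have hball : #(G.ballFinset {u, v} N) ≤ 2 * (k + 1) ^ N :=
    (G.card_ballFinset_le hG _ _).trans (Nat.mul_le_mul_right _ card_le_two)
  have hball' : (#(G.ballFinset {u, v} N) : ℝ) ≤ ((2 * (k + 1) ^ N : ℕ) : ℝ) := by
    exact_mod_cast hball
  rw [← Nat.cast_le (α := ℝ)]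
  refine le_trans ?_ (Nat.le_ceil _)
  rw [le_div_iff₀ (by linarith), mul_comm]
  exact hcard.trans (mul_le_mul_of_nonneg_left hball' (by linarith))

theorem SimpleGraph.finite_setOf_card_le (B : ℕ) :
    {p : Σ n : ℕ, SimpleGraph (Fin n) | p.1 ≤ B}.Finite := by
  refine (Set.finite_range
    fun p : Σ n : Fin (B + 1), SimpleGraph (Fin n) => (⟨p.1, p.2⟩ : Σ n : ℕ, SimpleGraph (Fin n))).subset ?_
  rintro ⟨n, H⟩ hn
  exact ⟨⟨⟨n, Nat.lt_succ_of_le hn⟩, H⟩, rfl⟩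

theorem mainTheorem6 (k : ℕ) (hk : 1 ≤ k) (lam : ℝ)
    (hlam : lam < 2 * Real.sqrt ((k : ℝ) - 1)) :
    ∃ S : Set (Σ n : ℕ, SimpleGraph (Fin n)), S.Finite ∧
      ∀ (V : Type*) [Fintype V] [DecidableEq V] (G : SimpleGraph V) [DecidableRel G.Adj]
        (hV : 1 < Fintype.card V),
        G.IsRegularOfDegree k → G.secondEigenvalue hV ≤ lam →
          ∃ H ∈ S, Nonempty (G ≃g H.2) := by
  obtain ⟨B, hB⟩ := exists_card_bound k hk lam hlam
  refine ⟨_, SimpleGraph.finite_setOf_card_le B, ?_⟩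
  intro V _ _ G _ hV hG hle
  exact ⟨⟨Fintype.card V, G.map (Fintype.equivFin V).toEmbedding⟩, hB V G hV hG hle,
    ⟨SimpleGraph.Iso.map (Fintype.equivFin V) G⟩⟩
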